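/- Let $M$ be a connected smooth $n$-manifold with frame bundle $FM$; the induced map of a local diffeomorphism $\psi$ of $M$ on frames is denoted $F\psi$. Let $\Pi^1(M,M)$ be the groupoid over $M$ of linear isomorphisms $T_xM\to T_yM$ (the $1$-jets $j^1_{x,y}\psi$ of local diffeomorphisms of $M$). Let $\tilde J^1(FM)$ be the second-order non-holonomic groupoid over $M$: its elements $j^1_{x,y}\Psi$ are the classes of $1$-jets $j^1_{X,\Psi(X)}\Psi$, $X$ a frame at $x$ and $\Psi(X)$ a frame at $y$, of local diffeomorphisms $\Psi$ of $FM$ commuting with the right action of $Gl(n,\mathbb R)$, modulo the action $j^1_{X,Y}\Psi\cdot g=j^1_{X\cdot g,Y\cdot g}\Psi$. Let $\tilde j^1(FM)\subseteq\tilde J^1(FM)$ be the holonomic groupoid, consisting of the elements $j^1_{x,y}(F\psi)$ with $\psi$ a local diffeomorphism of $M$. A section of $(\alpha,\beta)$ in $\Pi^1(M,M)$ (of $(\overline\alpha,\overline\beta)$ in $\tilde J^1(FM)$) is a smooth map that assigns to every $(x,y)\in M\times M$ an element with source $x$ and target $y$. A section $\mathcal Q$ of $\Pi^1(M,M)$ is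 integrable if it is a morphism of groupoids from the pair groupoid $M\times M$ and $M$ is covered by charts $\psi_U:U\to\mathbb R^n$ with $$\mathcal Q(x,y)=j^1_{x,y}\bigl(\psi_U^{-1}\circ\tau_{\psi_U(y)-\psi_U(x)}\circ\psi_U\bigr)\quad\text{for all }x,y\in U,$$ where $\tau_v$ is the translation by $v$. A section $\overline{\mathcal P}$ of $\tilde J^1(FM)$ is integrable if it is a morphism of groupoids from $M\times M$ and $M$ is covered by charts $\psi_U$ with $$\overline{\mathcal P}(x,y)=j^1_{x,y}\bigl(F(\psi_U^{-1}\circ\tau_{\psi_U(y)-\psi_U(x)}\circ\psi_U)\bigr)\quad\text{for all }x,y\in U.$$ The second-order non-holonomic prolongation $\mathcal P^1(\mathcal Q)$ of two sections $\mathcal P,\mathcal Q$ of $\Pi^1(M,M)$ is the section of $\tilde J^1(FM)$ whose value at $(x,y)$ is the class of the jets, at the frames over $x$, of the map $Z\mapsto\mathcal P(z,\psi_{xy}(z))\cdot Z$ ($Z$ a frame at $z$, for $z$ near $x$), where $\psi_{xy}$ is any local diffeomorphism with $\mathcal Q(x,y)=j^1_{x,y}\psi_{xy}$. It is called an integrable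 prolongation if $\mathcal Q$ is integrable. Proposition. Let $\overline{\mathcal P}$ be a section of $(\overline\alpha,\overline\beta)$ in $\tilde J^1(FM)$. Then $\overline{\mathcal P}$ is integrable if and only if $\overline{\mathcal P}=\mathcal P^1(\mathcal Q)$ is an integrable prolongation with $\mathcal P=\mathcal Q$. Moreover, an integrable prolongation $\mathcal P^1(\mathcal Q)$ is integrable if and only if it takes values in $\tilde j^1(FM)$. -/

import Mathlib

open Bundle Set
open scoped Manifold ContDiff

noncomputable section

namespace Cosserat

/-- A `1`-jet `j¹_{X,Y} f` on a manifold `N`: its source `X`, its target `Y = f X` and its tangent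
map `T_X N → T_Y N`. -/
structure Jet {F H : Type*} [NormedAddCommGroup F] [NormedSpace ℝ F] [TopologicalSpace H]
    (I : ModelWithCorners ℝ F H) (N : Type*) [TopologicalSpace N] [ChartedSpace H N] where
  src : N
  tgt : N
  deriv : TangentSpace I src →L[ℝ] TangentSpace I tgt

/-- The `1`-jet `j¹_{X, f X} f` of `f` at `X`. -/
def jet {F H : Type*} [NormedAddCommGroup F] [NormedSpace ℝ F] [TopologicalSpace H]
    (I : ModelWithCorners ℝ F H) {N : Type*} [TopologicalSpace N] [ChartedSpace H N]
    (f : N → N) (X : N) : Jet I N :=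
  ⟨X, f X, mfderiv I I f X⟩

theorem jet_comp_congr {F H : Type*} [NormedAddCommGroup F] [NormedSpace ℝ F] [TopologicalSpace H]
    {I : ModelWithCorners ℝ F H} {N : Type*} [TopologicalSpace N] [ChartedSpace H N]
    {g g' : N → N} {X Y Y' : N} {A : TangentSpace I X →L[ℝ] TangentSpace I Y}
    {A' : TangentSpace I X →L[ℝ] TangentSpace I Y'}
    (h : (⟨X, Y, A⟩ : Jet I N) = ⟨X, Y', A'⟩) (k : jet I g Y = jet I g' Y) :
    (⟨X, g Y, (mfderiv I I g Y).comp A⟩ : Jet I N) =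
      ⟨X, g' Y', (mfderiv I I g' Y').comp A'⟩ := by
  cases h
  unfold jet at k
  generalize mfderiv I I g Y = B at *
  generalize mfderiv I I g' Y = B' at *
  revert B B'
  generalize g Y = Z
  generalize g' Y = Z'
  intro B B' k
  cases k
  rfl

/-- The space `ℝⁿ`. -/
abbrev Rn (n : ℕ) := EuclideanSpace ℝ (Fin n)

/-- The model `ℝⁿ × End(ℝⁿ)` of the frame bundle. -/
abbrev FrameModel (n : ℕ) := (𝓡 n).prod 𝓘(ℝ, Rn n →L[ℝ] Rn n)

variable (n : ℕ) (M : Type*) [TopologicalSpace M] [ChartedSpace (Rn n) M] [IsManifold (𝓡 n) ∞ M]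

/-! ### The frame bundle and its local automorphisms -/

/-- The total space of the smooth vector bundle `Hom(ℝⁿ, TM)` over `M`: its points are the pairs
`(x, z)` with `x : M` and `z : ℝⁿ → T_x M` linear. -/
abbrev HomBundle :=
  TotalSpace (Rn n →L[ℝ] Rn n)
    (fun x : M => Bundle.Trivial M (Rn n) x →L[ℝ] TangentSpace (𝓡 n) x)

/-- The frame bundle `FM`, an open submanifold of `Hom(ℝⁿ, TM)`: a frame at `x` is a linear
isomorphism `z : ℝⁿ → T_x M`. -/
def frameBundle : Set (HomBundle n M) := {X | Function.Bijective X.2}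

variable {n M}

/-- The right action `z · g = z ∘ g` of the general linear group of `ℝⁿ`. -/
def HomBundle.act (X : HomBundle n M) (g : Rn n ≃L[ℝ] Rn n) : HomBundle n M :=
  ⟨X.1, X.2.comp (g : Rn n →L[ℝ] Rn n)⟩

variable (n M)

/-- A local automorphism of the principal bundle `FM` over the identity of the general linear
group: a smooth diffeomorphism between open subsets of `FM`, with invariant domain, which commutes
with the right action. -/
structure LocalAut extends
    PartialDiffeomorph (FrameModel n) (FrameModel n) (HomBundle n M) (HomBundle n M) ∞ where
  source_subset : source ⊆ frameBundle n M
  target_subset : target ⊆ frameBundle n M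
  act_mem : ∀ X ∈ source, ∀ g : Rn n ≃L[ℝ] Rn n, X.act g ∈ source
  map_act : ∀ X ∈ source, ∀ g : Rn n ≃L[ℝ] Rn n, toFun (X.act g) = (toFun X).act g

variable {M}

/-- The local automorphisms of `FM` that are defined on the fibre over `x` and map it to the fibre
over `y`. -/
structure LocalAutAt (x y : M) extends LocalAut n M where
  fibre_subset : ∀ X ∈ frameBundle n M, X.1 = x → X ∈ source
  map_fibre : ∀ X ∈ frameBundle n M, X.1 = x → (toFun X).1 = y

/-- The map `FM → FM`, `z ↦ T f ∘ z`, induced by `f : M → M` (meaningful over the open set where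
`f` is a local diffeomorphism). -/
def frameMap (f : M → M) : HomBundle n M → HomBundle n M :=
  fun X => ⟨f X.1, (mfderiv (𝓡 n) (𝓡 n) f X.1).comp X.2⟩

/-! ### The second-order non-holonomic groupoid -/

/-- The orbit of a jet `j¹_{X,Y} Ψ` under the action `j¹_{X,Y} Ψ · g = j¹_{X·g,Y·g} Ψ` of the general
linear group consists of the jets of `Ψ` at all the frames over the same point. So two local
automorphisms define the same element of the quotient groupoid if and only if they have the same
`1`-jet at each frame over `x`. -/
instance jetSetoid (x y : M) : Setoid (LocalAutAt n x y) where
  r Ψ Φ := ∀ X ∈ frameBundle n M, X.1 = x →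
    jet (FrameModel n) Ψ.toFun X = jet (FrameModel n) Φ.toFun X
  iseqv :=
    { refl := fun _ _ _ _ => rfl
      symm := fun h X hX hx => (h X hX hx).symm
      trans := fun h k X hX hx => (h X hX hx).trans (k X hX hx) }

/-- The elements `j¹_{x,y} Ψ` from `x` to `y` of the second-order non-holonomic groupoid over `M`. -/
def NHJet (x y : M) := Quotient (jetSetoid n x y)

variable {n}

/-- The representative with source `X` of an element of the quotient groupoid, for `X` a frame
over `x`. -/
def NHJet.at {x y : M} (a : NHJet n x y) (X : HomBundle n M) : Jet (FrameModel n) (HomBundle n M) :=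
  jet (FrameModel n) (Quotient.out a).toFun X

/-- `a = j¹_{x,y} f`, for a map `f` of `FM` defined near the fibre over `x`. -/
def NHJet.IsJetOf {x y : M} (a : NHJet n x y) (f : HomBundle n M → HomBundle n M) : Prop :=
  ∀ X ∈ frameBundle n M, X.1 = x → a.at X = jet (FrameModel n) f X

/-- Composition of local automorphisms. -/
def LocalAutAt.comp {x y z : M} (Φ : LocalAutAt n y z) (Ψ : LocalAutAt n x y) :
    LocalAutAt n x z where
  toPartialDiffeomorph := Ψ.toPartialDiffeomorph.trans Φ.toPartialDiffeomorph
  source_subset := fun _ hX => Ψ.source_subset hX.1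
  target_subset := fun _ hX => Φ.target_subset hX.1
  act_mem := fun X hX g => ⟨Ψ.act_mem X hX.1 g, by
    change Ψ.toFun (X.act g) ∈ Φ.source
    rw [Ψ.map_act X hX.1 g]
    exact Φ.act_mem _ hX.2 g⟩
  map_act := fun X hX g => by
    change Φ.toFun (Ψ.toFun (X.act g)) = (Φ.toFun (Ψ.toFun X)).act g
    exact (congrArg Φ.toFun (Ψ.map_act X hX.1 g)).trans (Φ.map_act _ hX.2 g)
  fibre_subset := fun X hX hx => ⟨Ψ.fibre_subset X hX hx, Φ.fibre_subset _
    (Ψ.target_subset (Ψ.map_source (Ψ.fibre_subset X hX hx))) (Ψ.map_fibre X hX hx)⟩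
  map_fibre := fun X hX hx => Φ.map_fibre _
    (Ψ.target_subset (Ψ.map_source (Ψ.fibre_subset X hX hx))) (Ψ.map_fibre X hX hx)

/-- The `1`-jets of a composition, through the chain rule. -/
theorem LocalAutAt.jet_comp {x y z : M} (Φ : LocalAutAt n y z) (Ψ : LocalAutAt n x y)
    (X : HomBundle n M) (hX : X ∈ frameBundle n M) (hx : X.1 = x) :
    jet (FrameModel n) (Φ.comp Ψ).toFun X =
      ⟨X, Φ.toFun (Ψ.toFun X),
        (mfderiv (FrameModel n) (FrameModel n) Φ.toFun (Ψ.toFun X)).comp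
          (mfderiv (FrameModel n) (FrameModel n) Ψ.toFun X)⟩ := by
  have h₁ := Ψ.fibre_subset X hX hx
  have h₂ := Φ.fibre_subset _ (Ψ.target_subset (Ψ.map_source h₁)) (Ψ.map_fibre X hX hx)
  have e : (Φ.comp Ψ).toFun = Φ.toFun ∘ Ψ.toFun := rfl
  have hd := mfderiv_comp X (Φ.mdifferentiableAt (by simp) h₂) (Ψ.mdifferentiableAt (by simp) h₁)
  unfold jet
  rw [e, hd]
  rfl

/-- The composition `j¹_{y,z} Φ · j¹_{x,y} Ψ = j¹_{x,z} (Φ ∘ Ψ)` of the second-order non-holonomic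
groupoid. -/
def NHJet.comp {x y z : M} (b : NHJet n y z) (a : NHJet n x y) : NHJet n x z :=
  Quotient.map₂ (fun Φ Ψ => Φ.comp Ψ) (by
    intro Φ Φ' hΦ Ψ Ψ' hΨ X hX hx
    have h₁ := hΨ X hX hx
    have h₂ := hΦ (Ψ.toFun X) (Ψ.target_subset (Ψ.map_source (Ψ.fibre_subset X hX hx)))
      (Ψ.map_fibre X hX hx)
    rw [LocalAutAt.jet_comp Φ Ψ X hX hx, LocalAutAt.jet_comp Φ' Ψ' X hX hx]
    exact jet_comp_congr h₁ h₂) b a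

/-- The element belongs to the second-order holonomic groupoid: it is `j¹_{x,y} (Fψ)` for a local
diffeomorphism `ψ` of `M`. -/
def NHJet.IsHolonomic {x y : M} (a : NHJet n x y) : Prop :=
  ∃ ψ : PartialDiffeomorph (𝓡 n) (𝓡 n) M M ∞, x ∈ ψ.source ∧ ψ x = y ∧ a.IsJetOf (frameMap n ψ)

/-! ### Sections -/

variable (n M)

/-- A smooth section of `(α, β)` in the `1`-jets groupoid of `M`, whose elements from `x` to `y` are
the linear isomorphisms `T_x M → T_y M`. Smoothness is smoothness of the matrix in coordinates. -/
structure JetSection where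
  toFun (x y : M) : TangentSpace (𝓡 n) x ≃L[ℝ] TangentSpace (𝓡 n) y
  smooth : ∀ q₀ : M × M, ContMDiffAt ((𝓡 n).prod (𝓡 n)) 𝓘(ℝ, Rn n →L[ℝ] Rn n) ∞
    (inTangentCoordinates (𝓡 n) (𝓡 n) (Prod.fst : M × M → M) Prod.snd
      (fun q => (toFun q.1 q.2 : TangentSpace (𝓡 n) q.1 →L[ℝ] TangentSpace (𝓡 n) q.2)) q₀) q₀

/-- A smooth section of `(α, β)` in the second-order non-holonomic groupoid. Smoothness is
smoothness of the lift `(X, y) ↦ j¹_{X,Y} Ψ`, where `j¹_{X,Y} Ψ` represents the value of the section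
at `(x, y)` and `X` is a frame over `x`: target and tangent map (in coordinates) depend smoothly on
`X` and `y`. -/
structure NHSection where
  toFun (x y : M) : NHJet n x y
  smooth_tgt : ∀ q₀ : HomBundle n M × M, q₀.1 ∈ frameBundle n M →
    ContMDiffAt ((FrameModel n).prod (𝓡 n)) (FrameModel n) ∞
      (fun q : HomBundle n M × M => ((toFun q.1.1 q.2).at q.1).tgt) q₀
  smooth_deriv : ∀ q₀ : HomBundle n M × M, q₀.1 ∈ frameBundle n M →
    ContMDiffAt ((FrameModel n).prod (𝓡 n))
      𝓘(ℝ, (Rn n × (Rn n →L[ℝ] Rn n)) →L[ℝ] (Rn n × (Rn n →L[ℝ] Rn n))) ∞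
      (inTangentCoordinates (FrameModel n) (FrameModel n)
        (fun q : HomBundle n M × M => q.1) (fun q => ((toFun q.1.1 q.2).at q.1).tgt)
        (fun q => ((toFun q.1.1 q.2).at q.1).deriv) q₀) q₀

variable {n M}

/-- In the chart `ψ`, the translation that takes `x` to `y`, as a map of `M`:
`ψ⁻¹ ∘ τ_{ψ y - ψ x} ∘ ψ`. -/
def chartTranslation (ψ : OpenPartialHomeomorph M (Rn n)) (x y : M) : M → M :=
  fun z => ψ.symm (ψ z + (ψ y - ψ x))

/-- Integrable sections of `(α, β)` in the `1`-jets groupoid of `M`: morphisms from the pair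
groupoid which are, over a covering of `M` by charts `ψ : U → ℝⁿ`, given by
`(x, y) ↦ j¹_{x,y} (ψ⁻¹ ∘ τ_{ψ y - ψ x} ∘ ψ)` on `U × U`. -/
def JetSection.IsIntegrable (Q : JetSection n M) : Prop :=
  (∀ x y z : M, (Q.toFun x y).trans (Q.toFun y z) = Q.toFun x z) ∧
  ∀ x₀ : M, ∃ ψ ∈ IsManifold.maximalAtlas (𝓡 n) ∞ M, x₀ ∈ ψ.source ∧
    ∀ x ∈ ψ.source, ∀ y ∈ ψ.source,
      jet (𝓡 n) (chartTranslation ψ x y) x = ⟨x, y, Q.toFun x y⟩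

/-- Integrable sections of `(α, β)` in the second-order non-holonomic groupoid: morphisms from the
pair groupoid (that is, parallelisms) such that `M` is covered by charts `ψ : U → ℝⁿ` for which
`j¹_{x,y} Ψ ↦ (ψ x, ψ y, j¹_{0,0} (F(τ_{-ψ y} ∘ ψ) ∘ Ψ ∘ F(ψ⁻¹ ∘ τ_{ψ x})))`
is an isomorphism from the parallelism over `U` to a trivial groupoid `ψ U × ψ U × G`. The isotropy
groups of a parallelism being trivial, `G` consists of the identity jet only, so that this says that
the section is `(x, y) ↦ j¹_{x,y} (F(ψ⁻¹ ∘ τ_{ψ y - ψ x} ∘ ψ))` on `U × U`. -/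
def NHSection.IsIntegrable (Pb : NHSection n M) : Prop :=
  (∀ x y z : M, (Pb.toFun y z).comp (Pb.toFun x y) = Pb.toFun x z) ∧
  ∀ x₀ : M, ∃ ψ ∈ IsManifold.maximalAtlas (𝓡 n) ∞ M, x₀ ∈ ψ.source ∧
    ∀ x ∈ ψ.source, ∀ y ∈ ψ.source,
      (Pb.toFun x y).IsJetOf (frameMap n (chartTranslation ψ x y))

/-- The map `FU → FV`, `X ↦ P(x, ψ x) · X` for `X` a frame at `x`, over `ψ : U → V`. -/
def JetSection.lift (P : JetSection n M) (ψ : M → M) : HomBundle n M → HomBundle n M :=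
  fun X => ⟨ψ X.1,
    (P.toFun X.1 (ψ X.1) : TangentSpace (𝓡 n) X.1 →L[ℝ] TangentSpace (𝓡 n) (ψ X.1)).comp X.2⟩

/-- `Pb = P¹(Q)`, the second-order non-holonomic prolongation of `P` and `Q`: for all `x`, `y`, if
`Q(x, y) = j¹_{x,y} ψ` then `Pb(x, y) = j¹_{x,y} (P ∘ ψ)`, with `P ∘ ψ` lifted to the frame bundle. -/
def IsProlongation (P Q : JetSection n M) (Pb : NHSection n M) : Prop :=
  ∀ x y : M, ∃ ψ : PartialDiffeomorph (𝓡 n) (𝓡 n) M M ∞, x ∈ ψ.source ∧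
    jet (𝓡 n) ψ x = ⟨x, y, Q.toFun x y⟩ ∧ (Pb.toFun x y).IsJetOf (P.lift ψ)

end Cosserat

end

noncomputable section

namespace Cosserat

open Filter Topology

variable {n : ℕ} {M : Type*} [TopologicalSpace M] [ChartedSpace (Rn n) M] [IsManifold (𝓡 n) ∞ M]

/-! ### Smooth maps into the frame bundle -/

/-! An element of the non-holonomic groupoid acts on frames through one linear isomorphism
`NHJet.iso`, so `Pb` induces a section `toJetSection`, the only candidate for `P = Q`. The proof
runs on parallel local diffeomorphisms of `Q`, those whose tangent map is `Q` at every point of the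
domain and not at one point only. For such a `ψ`, `Q.lift ψ` and `frameMap n ψ` agree on an open
set, so their jets agree (`IsParallel.jet_lift_eq`).

Chart translations of an integrable section are parallel, and parallel maps compose when `Q` is a
morphism. As `M` is connected, a parallel map joins any two points. If `Pb` is integrable, its value
at `(x, y)` is then the jet of `Fψ` with `ψ` parallel, which is both holonomic and a prolongation.
Conversely, the jet of `P.lift ψ` depends only on the 1-jet of `ψ` (`jet_lift`), so a parallel map
can replace the one supplied by `IsProlongation`; functoriality of `F` gives the morphism property,
and chart translations give the local form.

For the last claim, a holonomic prolongation has `P = Tφ` (from its action on frames) and `Q = Tφ`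
(from its action on base points), hence `P = Q`, which is the case already treated. -/

theorem contMDiff_homBundle_proj :
    ContMDiff (FrameModel n) (𝓡 n) ∞ (fun X : HomBundle n M => X.1) :=
  contMDiff_proj _

/-- Post-composing frames with linear maps which depend smoothly on a parameter is smooth. -/
theorem contMDiffAt_mk_comp {F H N : Type*} [NormedAddCommGroup F] [NormedSpace ℝ F]
    [TopologicalSpace H] {J : ModelWithCorners ℝ F H} [TopologicalSpace N] [ChartedSpace H N]
    {v : N → HomBundle n M} {b : N → M}
    {φ : ∀ q, TangentSpace (𝓡 n) (v q).1 →L[ℝ] TangentSpace (𝓡 n) (b q)} {q₀ : N}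
    (hv : ContMDiffAt J (FrameModel n) ∞ v q₀) (hb : ContMDiffAt J (𝓡 n) ∞ b q₀)
    (hφ : ContMDiffAt J 𝓘(ℝ, Rn n →L[ℝ] Rn n) ∞
      (inTangentCoordinates (𝓡 n) (𝓡 n) (fun q => (v q).1) b φ q₀) q₀) :
    ContMDiffAt J (FrameModel n) ∞
      (fun q => (⟨b q, (φ q).comp (v q).2⟩ : HomBundle n M)) q₀ := by
  rw [contMDiffAt_hom_bundle] at hv ⊢
  refine ⟨hb, (hφ.clm_comp hv.2).congr_of_eventuallyEq ?_⟩
  -- The factors `symmL` and `continuousLinearMapAt` between the two coordinate expressions cancel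
  -- only over the base set of the trivialization, hence only near `q₀`.
  have h₁ : ∀ᶠ q in 𝓝 q₀, (v q).1 ∈
      (trivializationAt (Rn n) (TangentSpace (𝓡 n)) (v q₀).1).baseSet :=
    hv.1.continuousAt ((trivializationAt (Rn n) (TangentSpace (𝓡 n)) (v q₀).1).open_baseSet.mem_nhds
      (FiberBundle.mem_baseSet_trivializationAt' _))
  filter_upwards [h₁] with q hq
  ext w : 1
  simp only [inTangentCoordinates, ContinuousLinearMap.inCoordinates,
    ContinuousLinearMap.comp_apply]
  rw [Trivialization.symmL_continuousLinearMapAt _ hq]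
  simp

/-- `P.lift ψ` is this map after `X ↦ (X, ψ X.1)`. Making the end point an independent variable
isolates the contribution of `ψ`. -/
theorem JetSection.contMDiff_comp (P : JetSection n M) :
    ContMDiff ((FrameModel n).prod (𝓡 n)) (FrameModel n) ∞
      (fun p : HomBundle n M × M => (⟨p.2,
        (P.toFun p.1.1 p.2 : TangentSpace (𝓡 n) p.1.1 →L[ℝ] TangentSpace (𝓡 n) p.2).comp
          p.1.2⟩ : HomBundle n M)) := by
  intro p
  refine contMDiffAt_mk_comp (v := Prod.fst) (b := Prod.snd)
    (φ := fun p => (P.toFun p.1.1 p.2 : TangentSpace (𝓡 n) p.1.1 →L[ℝ] TangentSpace (𝓡 n) p.2))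
    contMDiffAt_fst contMDiffAt_snd ?_
  exact (P.smooth (p.1.1, p.2)).comp p
    (f := fun p : HomBundle n M × M => (p.1.1, p.2))
    (((contMDiff_homBundle_proj _).comp p contMDiffAt_fst).prodMk contMDiffAt_snd)

theorem contMDiffAt_frameMap {f : M → M} {X : HomBundle n M}
    (hf : ContMDiffAt (𝓡 n) (𝓡 n) ∞ f X.1) :
    ContMDiffAt (FrameModel n) (FrameModel n) ∞ (frameMap n f) X := by
  refine contMDiffAt_mk_comp (v := id) (b := fun X => f X.1)
    (φ := fun X => mfderiv (𝓡 n) (𝓡 n) f X.1) contMDiffAt_id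
    (hf.comp X (contMDiff_homBundle_proj X)) ?_
  exact (hf.mfderiv_const (m := ∞) (by simp)).comp X (contMDiff_homBundle_proj X)

/-- The `1`-jet of `P.lift ψ` at a frame over `x` depends on the `1`-jet of `ψ` at `x` only. -/
theorem JetSection.jet_lift (P : JetSection n M) {ψ : M → M} {X : HomBundle n M}
    (hψ : MDifferentiableAt (𝓡 n) (𝓡 n) ψ X.1) {y : M}
    {A : TangentSpace (𝓡 n) X.1 →L[ℝ] TangentSpace (𝓡 n) y}
    (h : jet (𝓡 n) ψ X.1 = ⟨X.1, y, A⟩) :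
    jet (FrameModel n) (P.lift ψ) X = ⟨X,
      ⟨y, (P.toFun X.1 y : TangentSpace (𝓡 n) X.1 →L[ℝ] TangentSpace (𝓡 n) y).comp X.2⟩,
      (mfderiv ((FrameModel n).prod (𝓡 n)) (FrameModel n) (fun p : HomBundle n M × M => (⟨p.2,
        (P.toFun p.1.1 p.2 : TangentSpace (𝓡 n) p.1.1 →L[ℝ] TangentSpace (𝓡 n) p.2).comp
          p.1.2⟩ : HomBundle n M)) (X, y)).comp
        ((ContinuousLinearMap.id ℝ (TangentSpace (FrameModel n) X)).prod
          (A.comp (mfderiv (FrameModel n) (𝓡 n) (fun X : HomBundle n M => X.1) X)))⟩ := by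
  injection h with _ h₂ h₃
  subst h₂
  subst h₃
  have hπ : MDifferentiableAt (FrameModel n) (𝓡 n) (fun X : HomBundle n M => X.1) X :=
    (contMDiff_homBundle_proj X).mdifferentiableAt (by simp)
  have hc := mfderiv_comp (I' := 𝓡 n) X hψ hπ
  have hp := mfderiv_prodMk (f := id) (g := ψ ∘ fun X : HomBundle n M => X.1) (I := FrameModel n)
    (I' := FrameModel n) (I'' := 𝓡 n) (x := X) mdifferentiableAt_id (hψ.comp X hπ)
  have ht := mfderiv_comp X (I' := (FrameModel n).prod (𝓡 n))
    (f := fun X : HomBundle n M => (id X, (ψ ∘ fun X : HomBundle n M => X.1) X))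
    ((P.contMDiff_comp (X, ψ X.1)).mdifferentiableAt (by simp))
    (mdifferentiableAt_id.prodMk (hψ.comp X hπ))
  unfold jet
  refine congrArg (Jet.mk X _) ?_
  rw [hp, hc, mfderiv_id] at ht
  exact ht

/-! ### Elements of the second-order non-holonomic groupoid -/

namespace NHJet

theorem isJetOf_mk {x y : M} (Ψ : LocalAutAt n x y) :
    IsJetOf (Quotient.mk _ Ψ) Ψ.toFun :=
  fun X hX hx => Quotient.mk_out (s := jetSetoid n x y) Ψ X hX hx

theorem IsJetOf.congr {x y : M} {a : NHJet n x y} {f g : HomBundle n M → HomBundle n M}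
    (ha : a.IsJetOf f) (h : ∀ X ∈ frameBundle n M, X.1 = x →
      jet (FrameModel n) f X = jet (FrameModel n) g X) : a.IsJetOf g :=
  fun X hX hx => (ha X hX hx).trans (h X hX hx)

theorem IsJetOf.unique {x y : M} {a b : NHJet n x y} {f : HomBundle n M → HomBundle n M}
    (ha : a.IsJetOf f) (hb : b.IsJetOf f) : a = b := by
  rw [← Quotient.out_eq a, ← Quotient.out_eq b]
  exact Quotient.sound fun X hX hx => (ha X hX hx).trans (hb X hX hx).symm

theorem IsJetOf.comp {x y z : M} {a : NHJet n x y} {b : NHJet n y z}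
    {f g : HomBundle n M → HomBundle n M} (ha : a.IsJetOf f) (hb : b.IsJetOf g)
    (hf : ∀ X ∈ frameBundle n M, X.1 = x →
      MDifferentiableAt (FrameModel n) (FrameModel n) f X)
    (hg : ∀ X ∈ frameBundle n M, X.1 = y →
      MDifferentiableAt (FrameModel n) (FrameModel n) g X) :
    (b.comp a).IsJetOf (g ∘ f) := by
  induction a using Quotient.inductionOn with | _ Ψ
  induction b using Quotient.inductionOn with | _ Φ
  refine (isJetOf_mk (Φ.comp Ψ)).congr fun X hX hx => ?_
  have h₁ : jet (FrameModel n) Ψ.toFun X = jet (FrameModel n) f X :=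
    (isJetOf_mk Ψ X hX hx).symm.trans (ha X hX hx)
  have hY : Ψ.toFun X ∈ frameBundle n M :=
    Ψ.target_subset (Ψ.map_source (Ψ.fibre_subset X hX hx))
  have hy := Ψ.map_fibre X hX hx
  have h₂ : jet (FrameModel n) Φ.toFun (Ψ.toFun X) = jet (FrameModel n) g (Ψ.toFun X) :=
    (isJetOf_mk Φ _ hY hy).symm.trans (hb _ hY hy)
  have hfX : Ψ.toFun X = f X := congrArg Jet.tgt h₁
  rw [LocalAutAt.jet_comp Φ Ψ X hX hx, jet_comp_congr h₁ h₂, jet,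
    mfderiv_comp X (hg _ (hfX ▸ hY) (hfX ▸ hy)) (hf X hX hx)]
  rfl

variable (n) in
/-- The frame at `x` which the identification of `T_x M` with `ℝⁿ` provides. -/
def stdFrame (x : M) : HomBundle n M :=
  ⟨x, (ContinuousLinearMap.id ℝ (Rn n) : Rn n →L[ℝ] Rn n)⟩

set_option linter.unusedSectionVars false in
theorem stdFrame_mem (x : M) : stdFrame n x ∈ frameBundle n M :=
  Function.bijective_id

theorem tgt_mem {x y : M} (a : NHJet n x y) {X : HomBundle n M} (hX : X ∈ frameBundle n M)
    (hx : X.1 = x) : (a.at X).tgt ∈ frameBundle n M ∧ (a.at X).tgt.1 = y :=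
  ⟨(Quotient.out a).target_subset
    ((Quotient.out a).map_source ((Quotient.out a).fibre_subset X hX hx)),
    (Quotient.out a).map_fibre X hX hx⟩

/-- The linear isomorphism `T_x M → T_y M` by which an element of the groupoid acts on the frames
over `x`. -/
def iso {x y : M} (a : NHJet n x y) : TangentSpace (𝓡 n) x ≃L[ℝ] TangentSpace (𝓡 n) y :=
  (LinearEquiv.ofBijective
    (show Rn n →L[ℝ] Rn n from (a.at (stdFrame n x)).tgt.2 : Rn n →ₗ[ℝ] Rn n)
    (a.tgt_mem (stdFrame_mem x) rfl).1).toContinuousLinearEquiv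

/-- Any frame `Z` at `x` is `stdFrame n x` acted on by `g = Z`, so equivariance reduces the claim to
the standard frame. -/
theorem tgt_eq {x y : M} (a : NHJet n x y) {Z : Rn n →L[ℝ] TangentSpace (𝓡 n) x}
    (hZ : Function.Bijective Z) :
    (a.at ⟨x, Z⟩).tgt =
      ⟨y, (a.iso : TangentSpace (𝓡 n) x →L[ℝ] TangentSpace (𝓡 n) y).comp Z⟩ := by
  let g : Rn n ≃L[ℝ] Rn n := (LinearEquiv.ofBijective
    (show Rn n →L[ℝ] Rn n from Z : Rn n →ₗ[ℝ] Rn n) hZ).toContinuousLinearEquiv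
  have h : (a.at ⟨x, Z⟩).tgt = ((a.at (stdFrame n x)).tgt).act g :=
    (Quotient.out a).map_act (stdFrame n x)
      ((Quotient.out a).fibre_subset _ (stdFrame_mem x) rfl) g
  have hy := (a.tgt_mem (stdFrame_mem x) rfl).2
  have hi : ∀ w : Rn n, (a.iso w : Rn n) = (a.at (stdFrame n x)).tgt.2 w := fun _ => rfl
  rw [h]
  -- The target lies over `y` only propositionally; both objects are generalized so that `hy` can be
  -- substituted.
  generalize a.iso = B at hi
  revert hy hi
  generalize (a.at (stdFrame n x)).tgt = T
  intro hy hi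
  subst hy
  refine congrArg (TotalSpace.mk T.1) ?_
  ext w : 1
  exact (hi (Z w)).symm

/-- Compare the targets at the standard frame. An equality of jets also carries `z = y`, without
which the two linear maps have different types. It serves both for `frameMap` and for `P.lift ψ`. -/
theorem mk_iso_eq {x y z : M} {a : NHJet n x y} {F : HomBundle n M → HomBundle n M}
    (ha : a.IsJetOf F) {A : TangentSpace (𝓡 n) x →L[ℝ] TangentSpace (𝓡 n) z}
    (hF : ∀ Z : Rn n →L[ℝ] TangentSpace (𝓡 n) x, F ⟨x, Z⟩ = ⟨z, A.comp Z⟩) :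
    (⟨x, z, A⟩ : Jet (𝓡 n) M) = ⟨x, y, a.iso⟩ := by
  have h := (congrArg Jet.tgt (ha _ (stdFrame_mem x) rfl)).symm.trans
    (a.tgt_eq (Z := ContinuousLinearMap.id ℝ (Rn n)) Function.bijective_id)
  have h' := (hF (ContinuousLinearMap.id ℝ (Rn n))).symm.trans h
  injection h' with h₁ h₂
  subst h₁
  exact congrArg (Jet.mk x z) h₂

theorem jet_eq_iso {x y : M} {a : NHJet n x y} {f : M → M} (ha : a.IsJetOf (frameMap n f)) :
    jet (𝓡 n) f x = ⟨x, y, a.iso⟩ :=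
  mk_iso_eq ha fun _ => rfl

theorem iso_comp {x y z : M} (b : NHJet n y z) (a : NHJet n x y) :
    (b.comp a).iso = a.iso.trans b.iso := by
  have h : ((b.comp a).at (stdFrame n x)).tgt = (b.at (a.at (stdFrame n x)).tgt).tgt := by
    have hm := a.tgt_mem (stdFrame_mem x) rfl
    revert hm
    induction a using Quotient.inductionOn with | _ Ψ
    induction b using Quotient.inductionOn with | _ Φ
    intro hm
    have h₁ := congrArg Jet.tgt (isJetOf_mk (Φ.comp Ψ) (stdFrame n x) (stdFrame_mem x) rfl)
    have h₂ := congrArg Jet.tgt (isJetOf_mk Ψ (stdFrame n x) (stdFrame_mem x) rfl)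
    have h₃ := congrArg Jet.tgt (isJetOf_mk Φ _ hm.1 hm.2)
    exact h₁.trans ((congrArg Φ.toFun h₂).symm.trans h₃.symm)
  have e₁ := (b.comp a).tgt_eq (Z := ContinuousLinearMap.id ℝ (Rn n)) Function.bijective_id
  have e₂ := a.tgt_eq (Z := ContinuousLinearMap.id ℝ (Rn n)) Function.bijective_id
  -- `T_x M` unfolds to `ℝⁿ`, so `a.iso` is itself a frame at `y`: the image of the standard frame
  -- under `a`.
  have e₃ := b.tgt_eq (Z := show Rn n →L[ℝ] TangentSpace (𝓡 n) y from
    (a.iso : TangentSpace (𝓡 n) x →L[ℝ] TangentSpace (𝓡 n) y)) a.iso.bijective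
  have h' := e₁.symm.trans (h.trans ((congrArg (fun Y => (b.at Y).tgt) e₂).trans e₃))
  injection h' with _ h₂
  ext w : 2
  exact congrArg (fun B : Rn n →L[ℝ] Rn n => B w) h₂

end NHJet

/-! ### The linear part of a section -/

/-- The section `(x, y) ↦ Ψ(X) ∘ X⁻¹` in the `1`-jets groupoid of `M` which a section
`(x, y) ↦ j¹_{x,y} Ψ` in the second-order non-holonomic groupoid induces. -/
def NHSection.toJetSection (Pb : NHSection n M) : JetSection n M where
  toFun x y := (Pb.toFun x y).iso
  smooth q₀ := by
    let e := trivializationAt (Rn n) (TangentSpace (𝓡 n)) q₀.1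
    have hq : q₀.1 ∈ e.baseSet := FiberBundle.mem_baseSet_trivializationAt' _
    -- `stdFrame` need not vary smoothly with the point, so smoothness is tested on the local frame
    -- of a trivialization.
    let s : M → HomBundle n M := fun x => ⟨x, e.symmL ℝ x⟩
    have hs : ContMDiffAt (𝓡 n) (FrameModel n) ∞ s q₀.1 := e.contMDiffAt_symmL hq
    have hb : ∀ x ∈ e.baseSet, Function.Bijective (e.symmL ℝ x) := fun x hx => by
      rw [← e.symm_continuousLinearEquivAt_eq hx]
      exact (e.continuousLinearEquivAt ℝ x hx).symm.bijective
    have h := (Pb.smooth_tgt (s q₀.1, q₀.2) (hb _ hq)).comp q₀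
      (f := fun q : M × M => (s q.1, q.2)) ((hs.comp q₀ contMDiffAt_fst).prodMk contMDiffAt_snd)
    have hn : ∀ᶠ q : M × M in 𝓝 q₀, q.1 ∈ e.baseSet :=
      continuous_fst.continuousAt (e.open_baseSet.mem_nhds hq)
    have h' := h.congr_of_eventuallyEq (f₁ := fun q : M × M => (⟨q.2,
      ((Pb.toFun q.1 q.2).iso : TangentSpace (𝓡 n) q.1 →L[ℝ] TangentSpace (𝓡 n) q.2).comp
        (e.symmL ℝ q.1)⟩ : HomBundle n M))
      (hn.mono fun q hq => ((Pb.toFun q.1 q.2).tgt_eq (hb _ hq)).symm)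
    rw [contMDiffAt_hom_bundle] at h'
    refine h'.2.congr_of_eventuallyEq (Eventually.of_forall fun q => ?_)
    ext w : 1
    simp [inTangentCoordinates, ContinuousLinearMap.inCoordinates, e]

/-! ### Parallel local diffeomorphisms -/

theorem jet_congr {F H : Type*} [NormedAddCommGroup F] [NormedSpace ℝ F] [TopologicalSpace H]
    {I : ModelWithCorners ℝ F H} {N : Type*} [TopologicalSpace N] [ChartedSpace H N]
    {f g : N → N} {X : N} (h : f =ᶠ[𝓝 X] g) : jet I f X = jet I g X := by
  have key : ∀ (Y Y' : N) (A A' : F →L[ℝ] F), Y = Y' → A = A' →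
      (⟨X, Y, A⟩ : Jet I N) = ⟨X, Y', A'⟩ := by
    rintro Y _ A _ rfl rfl
    rfl
  exact key _ _ _ _ h.eq_of_nhds h.mfderiv_eq

/-- Local diffeomorphisms whose tangent maps are given by the section `Q`. -/
def JetSection.IsParallel (Q : JetSection n M)
    (ψ : PartialDiffeomorph (𝓡 n) (𝓡 n) M M ∞) : Prop :=
  ∀ z ∈ ψ.source, mfderiv (𝓡 n) (𝓡 n) ψ z = Q.toFun z (ψ z)

set_option linter.unusedSectionVars false in
theorem frameMap_trans {φ ψ : PartialDiffeomorph (𝓡 n) (𝓡 n) M M ∞} {X : HomBundle n M}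
    (hX : X.1 ∈ (φ.trans ψ).source) :
    frameMap n (φ.trans ψ) X = (frameMap n ψ ∘ frameMap n φ) X := by
  have h := mfderiv_comp X.1 (ψ.mdifferentiableAt (by simp) hX.2)
    (φ.mdifferentiableAt (by simp) hX.1)
  exact congrArg (fun A : Rn n →L[ℝ] Rn n =>
    (⟨ψ (φ X.1), A.comp (show Rn n →L[ℝ] Rn n from X.2)⟩ : HomBundle n M)) h

theorem jet_congr_of_eqOn {f g : HomBundle n M → HomBundle n M} {U : Set M} (hU : IsOpen U)
    (h : ∀ X : HomBundle n M, X.1 ∈ U → f X = g X) {X : HomBundle n M} (hX : X.1 ∈ U) :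
    jet (FrameModel n) f X = jet (FrameModel n) g X :=
  jet_congr (Filter.mem_of_superset
    ((hU.preimage contMDiff_homBundle_proj.continuous).mem_nhds hX) fun Y hY => h Y hY)

namespace JetSection

variable {Q : JetSection n M}

theorem IsParallel.trans (hQ : ∀ x y z, (Q.toFun x y).trans (Q.toFun y z) = Q.toFun x z)
    {φ ψ : PartialDiffeomorph (𝓡 n) (𝓡 n) M M ∞} (hφ : Q.IsParallel φ) (hψ : Q.IsParallel ψ) :
    Q.IsParallel (φ.trans ψ) := by
  intro z hz
  have h := mfderiv_comp (f := φ) (g := ψ) z (ψ.mdifferentiableAt (by simp) hz.2)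
    (φ.mdifferentiableAt (by simp) hz.1)
  rw [hφ z hz.1, hψ (φ z) hz.2] at h
  refine h.trans ?_
  have h' := hQ z (φ z) (ψ (φ z))
  exact congrArg (fun A : TangentSpace (𝓡 n) z ≃L[ℝ] TangentSpace (𝓡 n) (ψ (φ z)) =>
    (A : TangentSpace (𝓡 n) z →L[ℝ] TangentSpace (𝓡 n) (ψ (φ z)))) h'

/-- The jet of `frameMap n ψ` involves second derivatives of `ψ`, so agreement at one point would
not suffice; parallelism gives equality over all of `ψ.source`. -/
theorem IsParallel.jet_lift_eq {ψ : PartialDiffeomorph (𝓡 n) (𝓡 n) M M ∞}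
    (hψ : Q.IsParallel ψ) {X : HomBundle n M} (hX : X.1 ∈ ψ.source) :
    jet (FrameModel n) (Q.lift ψ) X = jet (FrameModel n) (frameMap n ψ) X :=
  jet_congr_of_eqOn ψ.open_source (fun Y hY =>
    congrArg (fun A : TangentSpace (𝓡 n) Y.1 →L[ℝ] TangentSpace (𝓡 n) (ψ Y.1) =>
      (⟨ψ Y.1, A.comp Y.2⟩ : HomBundle n M)) (hψ _ hY).symm) hX

theorem IsParallel.jet_eq {ψ : PartialDiffeomorph (𝓡 n) (𝓡 n) M M ∞}
    (hψ : Q.IsParallel ψ) {x : M} (hx : x ∈ ψ.source) :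
    jet (𝓡 n) ψ x = ⟨x, ψ x, Q.toFun x (ψ x)⟩ :=
  congrArg (Jet.mk x (ψ x)) (hψ x hx)

end JetSection

/-- The local diffeomorphism which is the translation by `v` in the chart `ψ`. -/
def chartTranslationDiffeo {ψ : OpenPartialHomeomorph M (Rn n)}
    (hψ : ψ ∈ IsManifold.maximalAtlas (𝓡 n) ∞ M) (v : Rn n) :
    PartialDiffeomorph (𝓡 n) (𝓡 n) M M ∞ where
  toPartialEquiv := ((ψ.trans (Homeomorph.addRight v).toOpenPartialHomeomorph).trans
    ψ.symm).toPartialEquiv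
  open_source := OpenPartialHomeomorph.open_source _
  open_target := OpenPartialHomeomorph.open_target _
  contMDiffOn_toFun := by
    have h : ContMDiff (𝓡 n) (𝓡 n) ∞ fun w : Rn n => w + v :=
      (contDiff_id.add contDiff_const).contMDiff
    refine (contMDiffOn_symm_of_mem_maximalAtlas hψ).comp
      (h.comp_contMDiffOn ((contMDiffOn_of_mem_maximalAtlas hψ).mono ?_)) ?_
    · exact fun z hz => hz.1.1
    · exact fun z hz => hz.2
  contMDiffOn_invFun := by
    have h : ContMDiff (𝓡 n) (𝓡 n) ∞ fun w : Rn n => w + -v :=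
      (contDiff_id.add contDiff_const).contMDiff
    refine (contMDiffOn_symm_of_mem_maximalAtlas hψ).comp
      (h.comp_contMDiffOn ((contMDiffOn_of_mem_maximalAtlas hψ).mono ?_)) ?_
    · exact fun z hz => hz.1
    · exact fun z hz => hz.2.2

set_option linter.unusedSectionVars false in
theorem mem_chartTranslationDiffeo_source {ψ : OpenPartialHomeomorph M (Rn n)}
    (hψ : ψ ∈ IsManifold.maximalAtlas (𝓡 n) ∞ M) {v : Rn n} {z : M} :
    z ∈ (chartTranslationDiffeo hψ v).source ↔ z ∈ ψ.source ∧ ψ z + v ∈ ψ.target :=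
  ⟨fun h => ⟨h.1.1, h.2⟩, fun h => ⟨⟨h.1, trivial⟩, h.2⟩⟩

theorem mem_chartTranslationDiffeo_source_of_mem {ψ : OpenPartialHomeomorph M (Rn n)}
    (hψ : ψ ∈ IsManifold.maximalAtlas (𝓡 n) ∞ M) {x y : M} (hx : x ∈ ψ.source)
    (hy : y ∈ ψ.source) : x ∈ (chartTranslationDiffeo hψ (ψ y - ψ x)).source :=
  (mem_chartTranslationDiffeo_source hψ).2 ⟨hx, by simpa using ψ.map_source hy⟩

set_option linter.unusedSectionVars false in
theorem chartTranslationDiffeo_apply {ψ : OpenPartialHomeomorph M (Rn n)}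
    (hψ : ψ ∈ IsManifold.maximalAtlas (𝓡 n) ∞ M) {x y : M} (hy : y ∈ ψ.source) :
    chartTranslationDiffeo hψ (ψ y - ψ x) x = y := by
  change ψ.symm (ψ x + (ψ y - ψ x)) = y
  rw [add_sub_cancel, ψ.left_inv hy]

/-- `chartTranslation ψ z y` depends on its end points only through `ψ y - ψ z`. A translation by a
fixed `v` is thus the one from `z` to its image, for every `z` of its domain. -/
theorem JetSection.isParallel_chartTranslationDiffeo {Q : JetSection n M}
    {ψ : OpenPartialHomeomorph M (Rn n)} (hψ : ψ ∈ IsManifold.maximalAtlas (𝓡 n) ∞ M)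
    (h : ∀ x ∈ ψ.source, ∀ y ∈ ψ.source,
      jet (𝓡 n) (chartTranslation ψ x y) x = ⟨x, y, Q.toFun x y⟩) (v : Rn n) :
    Q.IsParallel (chartTranslationDiffeo hψ v) := by
  intro z hz
  obtain ⟨h₁, h₂⟩ := (mem_chartTranslationDiffeo_source hψ).1 hz
  have hj := h z h₁ _ (ψ.map_target h₂)
  have hc : chartTranslation ψ z (ψ.symm (ψ z + v)) = chartTranslationDiffeo hψ v := by
    funext w
    change ψ.symm (ψ w + (ψ (ψ.symm (ψ z + v)) - ψ z)) = ψ.symm (ψ w + v)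
    rw [ψ.right_inv h₂, add_sub_cancel_left]
  rw [hc] at hj
  injection hj

/-! ### Integrable sections -/

theorem JetSection.IsIntegrable.exists_isParallel [PreconnectedSpace M] {Q : JetSection n M}
    (hQ : Q.IsIntegrable) (x y : M) :
    ∃ ψ : PartialDiffeomorph (𝓡 n) (𝓡 n) M M ∞, x ∈ ψ.source ∧ ψ x = y ∧ Q.IsParallel ψ := by
  refine PreconnectedSpace.induction₂' (fun x y : M =>
    ∃ ψ : PartialDiffeomorph (𝓡 n) (𝓡 n) M M ∞, x ∈ ψ.source ∧ ψ x = y ∧ Q.IsParallel ψ)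
    (fun x₀ => ?_) ⟨?_⟩ x y
  · obtain ⟨ψ, hψ, hx₀, h⟩ := hQ.2 x₀
    have key : ∀ x ∈ ψ.source, ∀ y ∈ ψ.source, ∃ φ : PartialDiffeomorph (𝓡 n) (𝓡 n) M M ∞,
        x ∈ φ.source ∧ φ x = y ∧ Q.IsParallel φ := fun x hx y hy =>
      ⟨chartTranslationDiffeo hψ (ψ y - ψ x), mem_chartTranslationDiffeo_source_of_mem hψ hx hy,
        chartTranslationDiffeo_apply hψ hy, isParallel_chartTranslationDiffeo hψ h _⟩
    -- The connectedness induction asks for the relation in both directions near `x₀`; the reverse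
    -- one is the opposite translation.
    filter_upwards [ψ.open_source.mem_nhds hx₀] with y hy
    exact ⟨key _ hx₀ _ hy, key _ hy _ hx₀⟩
  · rintro x _ _ ⟨φ, hx, rfl, hφ⟩ ⟨ψ, hy, rfl, hψ⟩
    exact ⟨φ.trans ψ, ⟨hx, hy⟩, rfl, hφ.trans hQ.1 hψ⟩

theorem NHJet.IsJetOf.frameMap_trans {x y z : M} {a : NHJet n x y} {b : NHJet n y z}
    {φ ψ : PartialDiffeomorph (𝓡 n) (𝓡 n) M M ∞} (hx : x ∈ φ.source) (hy : y ∈ ψ.source)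
    (hxy : φ x = y) (ha : a.IsJetOf (frameMap n φ)) (hb : b.IsJetOf (frameMap n ψ)) :
    (b.comp a).IsJetOf (frameMap n (φ.trans ψ)) := by
  have hd : ∀ (χ : PartialDiffeomorph (𝓡 n) (𝓡 n) M M ∞) (X : HomBundle n M), X.1 ∈ χ.source →
      MDifferentiableAt (FrameModel n) (FrameModel n) (frameMap n χ) X := fun χ X hX =>
    (contMDiffAt_frameMap (χ.contMDiffOn.contMDiffAt
      (χ.open_source.mem_nhds hX))).mdifferentiableAt (by simp)
  refine (ha.comp hb (fun X _ h => hd φ X (h ▸ hx)) (fun X _ h => hd ψ X (h ▸ hy))).congr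
    fun X _ h => ?_
  -- `F(ψ ∘ φ) = Fψ ∘ Fφ` is available only over the open source of the composite, which is enough
  -- for jets.
  refine (jet_congr_of_eqOn (φ.trans ψ).open_source (fun Y hY => Cosserat.frameMap_trans hY) ?_).symm
  subst h hxy
  exact ⟨hx, hy⟩

namespace NHSection

variable {Pb : NHSection n M}

theorem IsIntegrable.toJetSection (h : Pb.IsIntegrable) : Pb.toJetSection.IsIntegrable := by
  refine ⟨fun x y z => ?_, fun x₀ => ?_⟩
  · exact (NHJet.iso_comp _ _).symm.trans (congrArg NHJet.iso (h.1 x y z))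
  · obtain ⟨ψ, hψ, hx₀, hj⟩ := h.2 x₀
    exact ⟨ψ, hψ, hx₀, fun x hx y hy => NHJet.jet_eq_iso (hj x hx y hy)⟩

theorem IsIntegrable.exists_isParallel [PreconnectedSpace M] (h : Pb.IsIntegrable) (x y : M) :
    ∃ ψ : PartialDiffeomorph (𝓡 n) (𝓡 n) M M ∞, x ∈ ψ.source ∧ ψ x = y ∧
      Pb.toJetSection.IsParallel ψ ∧ (Pb.toFun x y).IsJetOf (frameMap n ψ) := by
  refine PreconnectedSpace.induction₂' (fun x y : M =>
    ∃ ψ : PartialDiffeomorph (𝓡 n) (𝓡 n) M M ∞, x ∈ ψ.source ∧ ψ x = y ∧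
      Pb.toJetSection.IsParallel ψ ∧ (Pb.toFun x y).IsJetOf (frameMap n ψ)) (fun x₀ => ?_) ⟨?_⟩ x y
  · obtain ⟨ψ, hψ, hx₀, hj⟩ := h.2 x₀
    have key : ∀ x ∈ ψ.source, ∀ y ∈ ψ.source, ∃ φ : PartialDiffeomorph (𝓡 n) (𝓡 n) M M ∞,
        x ∈ φ.source ∧ φ x = y ∧ Pb.toJetSection.IsParallel φ ∧
          (Pb.toFun x y).IsJetOf (frameMap n φ) := fun x hx y hy =>
      ⟨chartTranslationDiffeo hψ (ψ y - ψ x), mem_chartTranslationDiffeo_source_of_mem hψ hx hy,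
        chartTranslationDiffeo_apply hψ hy, JetSection.isParallel_chartTranslationDiffeo hψ
          (fun x hx y hy => NHJet.jet_eq_iso (hj x hx y hy)) _, hj x hx y hy⟩
    filter_upwards [ψ.open_source.mem_nhds hx₀] with y hy
    exact ⟨key _ hx₀ _ hy, key _ hy _ hx₀⟩
  · rintro x _ _ ⟨φ, hx, rfl, hφ, hφj⟩ ⟨ψ, hy, rfl, hψ, hψj⟩
    refine ⟨φ.trans ψ, ⟨hx, hy⟩, rfl, hφ.trans h.toJetSection.1 hψ, ?_⟩
    rw [← h.1 x (φ x)]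
    exact hφj.frameMap_trans hx hy rfl hψj

theorem IsIntegrable.isHolonomic [PreconnectedSpace M] (h : Pb.IsIntegrable) (x y : M) :
    (Pb.toFun x y).IsHolonomic :=
  let ⟨ψ, hx, hy, _, hj⟩ := h.exists_isParallel x y
  ⟨ψ, hx, hy, hj⟩

theorem IsIntegrable.isProlongation [PreconnectedSpace M] (h : Pb.IsIntegrable) :
    IsProlongation Pb.toJetSection Pb.toJetSection Pb := by
  intro x y
  obtain ⟨ψ, hx, rfl, hψ, hj⟩ := h.exists_isParallel x y
  exact ⟨ψ, hx, hψ.jet_eq hx, hj.congr fun X _ hX => (hψ.jet_lift_eq (hX ▸ hx)).symm⟩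

end NHSection

/-- The `φ` supplied by `IsProlongation` shares with `ψ` just the 1-jet at `x`. By `jet_lift` this
already gives the two lifts the same jets. -/
theorem IsProlongation.isJetOf_frameMap {Q : JetSection n M} {Pb : NHSection n M}
    (h : IsProlongation Q Q Pb) {ψ : PartialDiffeomorph (𝓡 n) (𝓡 n) M M ∞}
    (hψ : Q.IsParallel ψ) {x : M} (hx : x ∈ ψ.source) :
    (Pb.toFun x (ψ x)).IsJetOf (frameMap n ψ) := by
  obtain ⟨φ, hxφ, hφ, hj⟩ := h x (ψ x)
  refine hj.congr fun X _ hX => ?_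
  subst hX
  rw [← hψ.jet_lift_eq hx, Q.jet_lift (φ.mdifferentiableAt (by simp) hxφ) hφ,
    Q.jet_lift (ψ.mdifferentiableAt (by simp) hx) (hψ.jet_eq hx)]

theorem IsProlongation.isIntegrable [PreconnectedSpace M] {Q : JetSection n M}
    {Pb : NHSection n M} (h : IsProlongation Q Q Pb) (hQ : Q.IsIntegrable) : Pb.IsIntegrable := by
  refine ⟨fun x y z => ?_, fun x₀ => ?_⟩
  · obtain ⟨φ, hx, rfl, hφ⟩ := hQ.exists_isParallel x y
    obtain ⟨ψ, hy, rfl, hψ⟩ := hQ.exists_isParallel (φ x) z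
    -- Both sides are the jet of `F(ψ ∘ φ)`, because `φ.trans ψ` is again parallel.
    exact ((h.isJetOf_frameMap hφ hx).frameMap_trans hx hy rfl
      (h.isJetOf_frameMap hψ hy)).unique
        (h.isJetOf_frameMap (hφ.trans hQ.1 hψ) (x := x) ⟨hx, hy⟩)
  · obtain ⟨ψ, hψ, hx₀, hj⟩ := hQ.2 x₀
    refine ⟨ψ, hψ, hx₀, fun x hx y hy => ?_⟩
    have := h.isJetOf_frameMap (JetSection.isParallel_chartTranslationDiffeo hψ hj (ψ y - ψ x))
      (mem_chartTranslationDiffeo_source_of_mem hψ hx hy)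
    rwa [chartTranslationDiffeo_apply hψ hy] at this

/-! ### Holonomic prolongations -/

theorem exists_contMDiffAt_frame (x₀ : M) : ∃ s : M → HomBundle n M,
    ContMDiffAt (𝓡 n) (FrameModel n) ∞ s x₀ ∧ (∀ x, (s x).1 = x) ∧ s x₀ ∈ frameBundle n M := by
  let e := trivializationAt (Rn n) (TangentSpace (𝓡 n)) x₀
  have hx₀ : x₀ ∈ e.baseSet := FiberBundle.mem_baseSet_trivializationAt' _
  refine ⟨fun x => ⟨x, e.symmL ℝ x⟩, e.contMDiffAt_symmL hx₀, fun _ => rfl, ?_⟩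
  change Function.Bijective (e.symmL ℝ x₀)
  rw [← e.symm_continuousLinearEquivAt_eq hx₀]
  exact (e.continuousLinearEquivAt ℝ x₀ hx₀).symm.bijective

/-- The derivative of the base point along a jet of the frame bundle. -/
def Jet.baseDeriv (j : Jet (FrameModel n) (HomBundle n M)) :
    (Rn n × (Rn n →L[ℝ] Rn n)) →L[ℝ] Rn n :=
  (mfderiv (FrameModel n) (𝓡 n) (fun X : HomBundle n M => X.1) j.tgt).comp j.deriv

/-- Differentiate `π ∘ F = f ∘ π`, with `π` the projection to `M`. -/
theorem baseDeriv_jet {F : HomBundle n M → HomBundle n M} {f : M → M} (hF : ∀ X, (F X).1 = f X.1)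
    {X : HomBundle n M} (hd : MDifferentiableAt (FrameModel n) (FrameModel n) F X)
    (hf : MDifferentiableAt (𝓡 n) (𝓡 n) f X.1) :
    (jet (FrameModel n) F X).baseDeriv = (mfderiv (𝓡 n) (𝓡 n) f X.1).comp
      (mfderiv (FrameModel n) (𝓡 n) (fun X : HomBundle n M => X.1) X) := by
  have hπ : MDifferentiable (FrameModel n) (𝓡 n) (fun X : HomBundle n M => X.1) :=
    contMDiff_homBundle_proj.mdifferentiable (by simp)
  have h₁ := mfderiv_comp X (hπ (F X)) hd
  have h₂ := mfderiv_comp (g := f) X hf (hπ X)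
  have e : (fun X : HomBundle n M => X.1) ∘ F = f ∘ fun X : HomBundle n M => X.1 := funext hF
  rw [← h₂, ← e]
  exact h₁.symm

/-- Equal jets give `Tf ∘ Tπ = Tg ∘ Tπ` at a frame. A local section `s` through a frame has `Tπ ∘ Ts
= id`, which cancels `Tπ`. -/
theorem mfderiv_eq_of_jet_eq {F G : HomBundle n M → HomBundle n M} {f g : M → M}
    (hF : ∀ X, (F X).1 = f X.1) (hG : ∀ X, (G X).1 = g X.1) {x : M}
    (hFd : ∀ X : HomBundle n M, X.1 = x → MDifferentiableAt (FrameModel n) (FrameModel n) F X)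
    (hGd : ∀ X : HomBundle n M, X.1 = x → MDifferentiableAt (FrameModel n) (FrameModel n) G X)
    (hf : MDifferentiableAt (𝓡 n) (𝓡 n) f x) (hg : MDifferentiableAt (𝓡 n) (𝓡 n) g x)
    (h : ∀ X ∈ frameBundle n M, X.1 = x → jet (FrameModel n) F X = jet (FrameModel n) G X) :
    (mfderiv (𝓡 n) (𝓡 n) f x : Rn n →L[ℝ] Rn n) = mfderiv (𝓡 n) (𝓡 n) g x := by
  obtain ⟨s, hs, hsx, hsm⟩ := exists_contMDiffAt_frame (n := n) x
  have hπ : MDifferentiable (FrameModel n) (𝓡 n) (fun X : HomBundle n M => X.1) :=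
    contMDiff_homBundle_proj.mdifferentiable (by simp)
  have hj := congrArg Jet.baseDeriv (h (s x) hsm (hsx x))
  rw [baseDeriv_jet hF (hFd _ (hsx x)) (by rwa [hsx x]),
    baseDeriv_jet hG (hGd _ (hsx x)) (by rwa [hsx x])] at hj
  have hid := mfderiv_comp x (hπ (s x)) (hs.mdifferentiableAt (by simp))
  have e : (fun X : HomBundle n M => X.1) ∘ s = id := funext hsx
  rw [e, mfderiv_id] at hid
  ext w : 1
  have hw := congrArg (fun A : (Rn n × (Rn n →L[ℝ] Rn n)) →L[ℝ] Rn n =>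
    A (mfderiv (𝓡 n) (FrameModel n) s x w)) hj
  have hidw : mfderiv (FrameModel n) (𝓡 n) (fun X : HomBundle n M => X.1) (s x)
    (mfderiv (𝓡 n) (FrameModel n) s x w) = w := congrArg (fun A : Rn n →L[ℝ] Rn n => A w) hid.symm
  have hw' : (mfderiv (𝓡 n) (𝓡 n) f (s x).1 : Rn n →L[ℝ] Rn n)
        (mfderiv (FrameModel n) (𝓡 n) (fun X : HomBundle n M => X.1) (s x)
          (mfderiv (𝓡 n) (FrameModel n) s x w)) =
      (mfderiv (𝓡 n) (𝓡 n) g (s x).1 : Rn n →L[ℝ] Rn n)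
        (mfderiv (FrameModel n) (𝓡 n) (fun X : HomBundle n M => X.1) (s x)
          (mfderiv (𝓡 n) (FrameModel n) s x w)) := hw
  rw [hidw, hsx x] at hw'
  exact hw'

theorem JetSection.mdifferentiableAt_lift (P : JetSection n M) {ψ : M → M} {X : HomBundle n M}
    (hψ : MDifferentiableAt (𝓡 n) (𝓡 n) ψ X.1) :
    MDifferentiableAt (FrameModel n) (FrameModel n) (P.lift ψ) X :=
  ((P.contMDiff_comp (X, ψ X.1)).mdifferentiableAt (by simp)).comp X
    (f := fun X : HomBundle n M => (X, ψ X.1)) (mdifferentiableAt_id.prodMk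
      (hψ.comp X ((contMDiff_homBundle_proj X).mdifferentiableAt (by simp))))

/-- A holonomic prolongation of `P` and `Q` forces `P = Q`: the jets of `Fφ` determine the tangent
map of `φ` twice, through the frames and through the base points. -/
theorem IsProlongation.eq_of_isHolonomic {P Q : JetSection n M} {Pb : NHSection n M}
    (h : IsProlongation P Q Pb) (hol : ∀ x y, (Pb.toFun x y).IsHolonomic) : P = Q := by
  have key : ∀ x y, P.toFun x y = Q.toFun x y := by
    intro x y
    obtain ⟨φ, hxφ, -, hφj⟩ := hol x y
    obtain ⟨ψ, hxψ, hψ, hψj⟩ := h x y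
    have hdφ := φ.mdifferentiableAt (by simp) hxφ
    have hdψ := ψ.mdifferentiableAt (by simp) hxψ
    have h₁ := mfderiv_eq_of_jet_eq (F := frameMap n φ) (G := P.lift ψ) (f := φ) (g := ψ)
      (fun _ => rfl) (fun _ => rfl)
      (fun X hX => (contMDiffAt_frameMap (φ.contMDiffOn.contMDiffAt
        (φ.open_source.mem_nhds (hX ▸ hxφ)))).mdifferentiableAt (by simp))
      (fun X hX => P.mdifferentiableAt_lift (by rwa [hX])) hdφ hdψ
      (fun X hX hx => (hφj X hX hx).symm.trans (hψj X hX hx))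
    have hy : ψ x = y := congrArg Jet.tgt hψ
    have h₂ := NHJet.jet_eq_iso hφj
    have h₃ := NHJet.mk_iso_eq hψj (z := ψ x)
      (A := (P.toFun x (ψ x) : TangentSpace (𝓡 n) x →L[ℝ] TangentSpace (𝓡 n) (ψ x))) fun _ => rfl
    -- `D` forgets the end points, so tangent maps with propositionally equal targets can be
    -- chained: `P = iso = Tφ = Tψ = Q`.
    let D : Jet (𝓡 n) M → Rn n →L[ℝ] Rn n := fun j => j.deriv
    have e₂ := congrArg D h₂
    have e₃ := congrArg D h₃
    have e₄ := congrArg D hψ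
    rw [hy] at e₃
    have e : D ⟨x, y, P.toFun x y⟩ = D ⟨x, y, Q.toFun x y⟩ :=
      e₃.trans (e₂.symm.trans (h₁.trans e₄))
    ext w : 2
    exact congrArg (fun A : Rn n →L[ℝ] Rn n => A w) e
  cases P
  cases Q
  congr
  exact funext fun x => funext fun y => key x y

end Cosserat

end

theorem mainTheorem9 (n : ℕ) (M : Type*) [TopologicalSpace M]
    [ChartedSpace (EuclideanSpace ℝ (Fin n)) M] [IsManifold (𝓡 n) ∞ M] [PreconnectedSpace M]
    (Pb : Cosserat.NHSection n M) :
    (Pb.IsIntegrable ↔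
      ∃ P Q : Cosserat.JetSection n M,
        Cosserat.IsProlongation P Q Pb ∧ Q.IsIntegrable ∧ P = Q) ∧
    (∀ P Q : Cosserat.JetSection n M, Cosserat.IsProlongation P Q Pb → Q.IsIntegrable →
      (Pb.IsIntegrable ↔ ∀ x y : M, (Pb.toFun x y).IsHolonomic)) := by
  refine ⟨⟨fun h => ⟨_, _, h.isProlongation, h.toJetSection, rfl⟩, ?_⟩, fun P Q h hQ =>
    ⟨fun hPb => hPb.isHolonomic, fun hol => ?_⟩⟩
  · rintro ⟨P, _, h, hQ, rfl⟩
    exact h.isIntegrable hQ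
  · obtain rfl := h.eq_of_isHolonomic hol
    exact h.isIntegrable hQ
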